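/- Let $d\ge 2$ and let $\Omega\subset\mathbb{R}^d$ be a non-empty, open, bounded and convex set. Let $|\Omega|$ be its Lebesgue measure, $\mathrm{diam}(\Omega)$ its diameter, $\rho(\Omega)=\sup_{x\in\Omega}\sup\{r>0: B_r(x)\subset\Omega\}$ its inradius, and $P(\Omega)=\sup\{\int_\Omega \mathrm{div}\,\varphi\,dx:\ \varphi\in C^1_c(\mathbb{R}^d;\mathbb{R}^d),\ |\varphi|\le 1\}$ its perimeter, and let $\omega_d=|B_1|$ be the measure of the unit ball in $\mathbb{R}^d$. Then $0<P(\Omega)<\infty$, and $$\frac{|\Omega|^{(d-1)/d}}{P(\Omega)}\le \frac{d^{(d-1)/d}}{\omega_d^{1/d}}\Big(\frac{2\rho(\Omega)}{\mathrm{diam}(\Omega)}\Big)^{1/d},$$ $$\mathrm{diam}(\Omega)\le \frac{2d^{d-1}}{\omega_d}\,\frac{P(\Omega)^{d-1}}{|\Omega|^{d-2}},$$ $$\frac{|\Omega|^{(d-1)/d}}{P(\Omega)}\ge \frac{1}{d\,\omega_d^{1/d}}\,\frac{2\rho(\Omega)}{\mathrm{diam}(\Omega)}.$$ -/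

import Mathlib

open MeasureTheory
open scoped ENNReal

/-- The measure `ω_d` of the unit ball `B_1` of `ℝ^d`. -/
noncomputable def unitBallVolume (d : ℕ) : ℝ :=
  volume.real (Metric.ball (0 : EuclideanSpace ℝ (Fin d)) 1)

/-- The divergence `∑ i, ∂_i φ_i` of a vector field on `ℝ^d`. -/
noncomputable def divergence {d : ℕ}
    (φ : EuclideanSpace ℝ (Fin d) → EuclideanSpace ℝ (Fin d))
    (x : EuclideanSpace ℝ (Fin d)) : ℝ :=
  ∑ i : Fin d, (fderiv ℝ φ x (EuclideanSpace.single i 1)) i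

/-- The perimeter (in the sense of De Giorgi) of a measurable set `A ⊆ ℝ^d`:
the supremum of `∫_A div φ` over the compactly supported `C^1` vector fields `φ`
with `|φ| ≤ 1`. The field `φ = 0` is admissible, so truncating the integrals at `0`
does not change the supremum. -/
noncomputable def perimeter {d : ℕ} (A : Set (EuclideanSpace ℝ (Fin d))) : ℝ≥0∞ :=
  ⨆ (φ : EuclideanSpace ℝ (Fin d) → EuclideanSpace ℝ (Fin d))
    (_ : ContDiff ℝ 1 φ ∧ HasCompactSupport φ ∧ ∀ x, ‖φ x‖ ≤ 1),
    ENNReal.ofReal (∫ x in A, divergence φ x)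

/-- The inradius of a bounded set `A`: the supremum of the radii `r > 0` of the open balls
`B_r(x)`, `x ∈ A`, that are contained in `A`. -/
noncomputable def inradius {d : ℕ} (A : Set (EuclideanSpace ℝ (Fin d))) : ℝ :=
  sSup {r : ℝ | 0 < r ∧ ∃ x ∈ A, Metric.ball x r ⊆ A}

/-! Write V, P, ρ, D, ω for volume, perimeter, inradius, diameter and unit ball volume. Everything
follows from four inequalities free of fractional powers. The upper bound on D combines V ≤ ρP with
Dωρ^(d-1) ≤ 2d^(d-1)V; multiplied by V ≤ ρP, it gives the first displayed estimate. The last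
estimate combines ρP ≤ dV with V ≤ ω(D/2)^d.

ρP ≤ dV (`perimeter_le_of_ball_subset`): test fields are paired with a Lipschitz cutoff built from
the gauge of Ω about the centre of an inscribed ball, and the transition layer is shrunk.

V ≤ ρP (`volume_le_mul_perimeter`): let δ be the distance to the complement. Formally ∇(-δ) is an
admissible field with nonnegative divergence, so V = ∫|∇δ|² = ∫ δ div ∇(-δ) ≤ ρP. Concavity of δ
allows this to be done with smooth convex approximations of -δ.

Dωρ^(d-1) ≤ 2d^(d-1)V (`dist_mul_pow_le_volume`): an inscribed ball joined to two far points
contains two disjoint half ellipsoids.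

V ≤ ω(D/2)^d is the isodiametric inequality, by Steiner symmetrization. -/

open scoped Pointwise

/-! ### Steiner symmetrization and the isodiametric inequality -/

/-- The Steiner symmetrization of `A` in the `i`-th coordinate direction. -/
def steinerSymm {ι : Type*} [DecidableEq ι] (i : ι) (A : Set (ι → ℝ)) : Set (ι → ℝ) :=
  {x | ENNReal.ofReal (2 * |x i|) < volume {t : ℝ | Function.update x i t ∈ A}}

section Steiner

variable {ι : Type*} [DecidableEq ι]

lemma lintegral_indicator_update (i : ι) {A : Set (ι → ℝ)} (hA : MeasurableSet A) (x : ι → ℝ) :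
    ∫⁻ t : ℝ, A.indicator 1 (Function.update x i t) =
      volume {t : ℝ | Function.update x i t ∈ A} := by
  have h : MeasurableSet {t : ℝ | Function.update x i t ∈ A} := measurable_update x hA
  rw [← lintegral_indicator_one h]
  rfl

lemma measurable_volume_slice [Fintype ι] (i : ι) {A : Set (ι → ℝ)} (hA : MeasurableSet A) :
    Measurable fun x : ι → ℝ => volume {t : ℝ | Function.update x i t ∈ A} := by
  have h := (measurable_one.indicator hA : Measurable (A.indicator (1 : (ι → ℝ) → ℝ≥0∞))).lmarginal
    (fun _ => (volume : Measure ℝ)) (s := {i})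
  rw [lmarginal_singleton] at h
  convert h using 2 with x
  exact (lintegral_indicator_update i hA x).symm

lemma measurableSet_steinerSymm [Fintype ι] (i : ι) {A : Set (ι → ℝ)} (hA : MeasurableSet A) :
    MeasurableSet (steinerSymm i A) :=
  measurableSet_lt (by fun_prop) (measurable_volume_slice i hA)

lemma volume_setOf_two_mul_abs_lt (m : ℝ≥0∞) :
    volume {t : ℝ | ENNReal.ofReal (2 * |t|) < m} = m := by
  rcases eq_or_ne m ⊤ with rfl | hm
  · simp only [ENNReal.ofReal_lt_top]
    simp
  · lift m to NNReal using hm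
    have : {t : ℝ | ENNReal.ofReal (2 * |t|) < m} = Set.Ioo (-(m / 2 : ℝ)) (m / 2) := by
      ext t
      simp only [Set.mem_ofPred_eq, Set.mem_Ioo, ← abs_lt]
      rw [ENNReal.ofReal_lt_coe_iff (by positivity)]
      constructor <;> intro h <;> linarith
    rw [this, Real.volume_Ioo]
    ring_nf
    simp

lemma volume_steinerSymm [Fintype ι] (i : ι) {A : Set (ι → ℝ)} (hA : MeasurableSet A) :
    volume (steinerSymm i A) = volume A := by
  have hS := measurableSet_steinerSymm i hA
  rw [← lintegral_indicator_one hS, ← lintegral_indicator_one hA]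
  refine lintegral_eq_of_lmarginal_eq {i} (measurable_one.indicator hS)
    (measurable_one.indicator hA) ?_
  rw [lmarginal_singleton, lmarginal_singleton]
  ext x
  rw [lintegral_indicator_update i hS, lintegral_indicator_update i hA]
  simp only [steinerSymm, Set.mem_ofPred_eq, Function.update_idem, Function.update_self]
  exact volume_setOf_two_mul_abs_lt _

lemma update_neg_mem_steinerSymm (i : ι) {A : Set (ι → ℝ)} {x : ι → ℝ}
    (hx : x ∈ steinerSymm i A) : Function.update x i (-x i) ∈ steinerSymm i A := by
  simpa [steinerSymm] using hx

/-- Reflecting in coordinate `j` embeds the `i`-slice through `x` in the `i`-slice through the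
reflected point. Hence later symmetrizations keep the earlier symmetries. -/
lemma update_neg_mem_steinerSymm_of_ne {i j : ι} (hij : j ≠ i) {A : Set (ι → ℝ)}
    (hA : ∀ x ∈ A, Function.update x j (-x j) ∈ A) {x : ι → ℝ}
    (hx : x ∈ steinerSymm i A) : Function.update x j (-x j) ∈ steinerSymm i A := by
  simp only [steinerSymm, Set.mem_ofPred_eq, Function.update_of_ne hij.symm] at hx ⊢
  refine hx.trans_le (measure_mono fun t ht => ?_)
  have := hA _ ht
  rwa [Function.update_comm hij.symm, Function.update_of_ne hij] at this

/-- The lengths of the hulls add up to (sup S - inf T) + (sup T - inf S), and each bracket is at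
most `c`. -/
lemma volume_add_volume_le_of_abs_sub_le {S T : Set ℝ} {c : ℝ} (hS : S.Nonempty) (hT : T.Nonempty)
    (h : ∀ s ∈ S, ∀ t ∈ T, |s - t| ≤ c) :
    volume S + volume T ≤ ENNReal.ofReal (2 * c) := by
  obtain ⟨s₀, hs₀⟩ := hS
  obtain ⟨t₀, ht₀⟩ := hT
  have hSb : BddBelow S := ⟨t₀ - c, fun s hs => by linarith [abs_le.1 (h s hs t₀ ht₀)]⟩
  have hSa : BddAbove S := ⟨t₀ + c, fun s hs => by linarith [abs_le.1 (h s hs t₀ ht₀)]⟩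
  have hTb : BddBelow T := ⟨s₀ - c, fun t ht => by linarith [abs_le.1 (h s₀ hs₀ t ht)]⟩
  have hTa : BddAbove T := ⟨s₀ + c, fun t ht => by linarith [abs_le.1 (h s₀ hs₀ t ht)]⟩
  have h1 : sSup S ≤ sInf T + c := csSup_le ⟨s₀, hs₀⟩ fun s hs => by
    rw [← sub_le_iff_le_add]
    exact le_csInf ⟨t₀, ht₀⟩ fun t ht => by linarith [abs_le.1 (h s hs t ht)]
  have h2 : sSup T ≤ sInf S + c := csSup_le ⟨t₀, ht₀⟩ fun t ht => by
    rw [← sub_le_iff_le_add]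
    exact le_csInf ⟨s₀, hs₀⟩ fun s hs => by linarith [abs_le.1 (h s hs t ht)]
  have hS' : volume S ≤ ENNReal.ofReal (sSup S - sInf S) := by
    rw [← Real.volume_Icc]
    exact measure_mono fun s hs => ⟨csInf_le hSb hs, le_csSup hSa hs⟩
  have hT' : volume T ≤ ENNReal.ofReal (sSup T - sInf T) := by
    rw [← Real.volume_Icc]
    exact measure_mono fun s hs => ⟨csInf_le hTb hs, le_csSup hTa hs⟩
  refine (add_le_add hS' hT').trans ?_
  rw [← ENNReal.ofReal_add (sub_nonneg.2 ((csInf_le hSb hs₀).trans (le_csSup hSa hs₀)))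
    (sub_nonneg.2 ((csInf_le hTb ht₀).trans (le_csSup hTa ht₀)))]
  exact ENNReal.ofReal_le_ofReal (by linarith)

/-- If the bound failed, any points `s`, `t` of the two slices would satisfy |s - t| ≤ |x i - y i| ≤
|x i| + |y i|. The slices would then have total length at most 2(|x i| + |y i|), against the strict
inequalities defining the symmetrization. -/
lemma sum_sq_sub_le_of_mem_steinerSymm [Fintype ι] (i : ι) {A : Set (ι → ℝ)} {C : ℝ}
    (hA : ∀ x ∈ A, ∀ y ∈ A, ∑ j, (x j - y j) ^ 2 ≤ C) {x y : ι → ℝ}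
    (hx : x ∈ steinerSymm i A) (hy : y ∈ steinerSymm i A) : ∑ j, (x j - y j) ^ 2 ≤ C := by
  by_contra! hC
  have hne : ∀ {z}, z ∈ steinerSymm i A → {t : ℝ | Function.update z i t ∈ A}.Nonempty := by
    intro z hz
    rw [Set.nonempty_iff_ne_empty]
    intro h0
    simp [steinerSymm, h0] at hz
  have hlt := ENNReal.add_lt_add hx hy
  refine absurd hlt (not_lt.2 ?_)
  rw [← ENNReal.ofReal_add (by positivity) (by positivity), ← mul_add]
  refine volume_add_volume_le_of_abs_sub_le (hne hx) (hne hy) fun s hs t ht => ?_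
  have h := (hA _ hs _ ht).trans hC.le
  rw [← Finset.add_sum_erase _ _ (Finset.mem_univ i),
    ← Finset.add_sum_erase _ (fun j => (x j - y j) ^ 2) (Finset.mem_univ i),
    Finset.sum_congr rfl (g := fun j => (x j - y j) ^ 2)
      (fun j hj => by simp [Function.update_of_ne (Finset.ne_of_mem_erase hj)])] at h
  simp only [Function.update_self, add_le_add_iff_right] at h
  exact (sq_le_sq.1 h).trans (abs_sub _ _)

lemma exists_symm_volume_eq [Fintype ι] {A : Set (ι → ℝ)} {C : ℝ} (hm : MeasurableSet A)
    (hA : ∀ x ∈ A, ∀ y ∈ A, ∑ j, (x j - y j) ^ 2 ≤ C) (s : Finset ι) :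
    ∃ B : Set (ι → ℝ), MeasurableSet B ∧ volume B = volume A ∧
      (∀ x ∈ B, ∀ y ∈ B, ∑ j, (x j - y j) ^ 2 ≤ C) ∧
      ∀ j ∈ s, ∀ x ∈ B, Function.update x j (-x j) ∈ B := by
  induction s using Finset.induction_on with
  | empty => exact ⟨A, hm, rfl, hA, by simp⟩
  | insert i s hi ih =>
    obtain ⟨B, hBm, hBv, hBC, hBs⟩ := ih
    refine ⟨steinerSymm i B, measurableSet_steinerSymm i hBm, (volume_steinerSymm i hBm).trans hBv,
      fun x hx y hy => sum_sq_sub_le_of_mem_steinerSymm i hBC hx hy, fun j hj x hx => ?_⟩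
    rcases eq_or_ne j i with rfl | hji
    · exact update_neg_mem_steinerSymm j hx
    · exact update_neg_mem_steinerSymm_of_ne hji
        (hBs j (Finset.mem_of_mem_insert_of_ne hj hji)) hx

lemma neg_mem_of_forall_update_neg_mem [Fintype ι] {B : Set (ι → ℝ)}
    (hB : ∀ j, ∀ x ∈ B, Function.update x j (-x j) ∈ B) {x : ι → ℝ} (hx : x ∈ B) : -x ∈ B := by
  have h : ∀ s : Finset ι, (fun j => if j ∈ s then -x j else x j) ∈ B := by
    intro s
    induction s using Finset.induction_on with
    | empty => simpa using hx
    | insert i s hi ih =>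
      convert hB i _ ih using 1
      ext j
      rcases eq_or_ne j i with rfl | hji
      · simp [hi]
      · simp [hji]
  convert h Finset.univ using 1
  ext j
  simp

end Steiner

/-- The isodiametric inequality. -/
theorem volume_le_volume_ball_half_diam {ι : Type*} [Fintype ι] {A : Set (EuclideanSpace ℝ ι)}
    (hm : MeasurableSet A) (hb : Bornology.IsBounded A) :
    volume A ≤ volume (Metric.closedBall (0 : EuclideanSpace ℝ ι) (Metric.diam A / 2)) := by
  classical
  have hmp := PiLp.volume_preserving_toLp ι
  have hD := Metric.diam_nonneg (s := A)
  obtain ⟨B, hBm, hBv, hBC, hBs⟩ := exists_symm_volume_eq (A := WithLp.toLp 2 ⁻¹' A)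
    (C := Metric.diam A ^ 2) (hmp.measurable hm) (fun x hx y hy => by
      have := Metric.dist_le_diam_of_mem hb hx hy
      rw [EuclideanSpace.dist_eq, Real.sqrt_le_left hD] at this
      simpa [Real.dist_eq, sq_abs] using this) Finset.univ
  rw [← hmp.measure_preimage hm.nullMeasurableSet, ← hBv,
    ← hmp.measure_preimage measurableSet_closedBall.nullMeasurableSet]
  -- The symmetrized set contains `-x` along with `x`, so 2‖x‖ is at most the diameter.
  refine measure_mono fun x hx => ?_
  have := hBC x hx (-x) (neg_mem_of_forall_update_neg_mem (fun j => hBs j (Finset.mem_univ j)) hx)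
  rw [Set.mem_preimage, mem_closedBall_zero_iff, EuclideanSpace.norm_eq,
    Real.sqrt_le_left (by positivity)]
  have h2 : ∑ j, (x j - (-x) j) ^ 2 = 4 * ∑ j, x j ^ 2 := by
    rw [Finset.mul_sum]
    exact Finset.sum_congr rfl fun j _ => by simp; ring
  rw [h2] at this
  simp only [Real.norm_eq_abs, sq_abs]
  linarith [show (Metric.diam A / 2) ^ 2 = Metric.diam A ^ 2 / 4 by ring]

/-! ### Integration by parts and the upper bound on the perimeter -/

section Divergence

variable {d : ℕ}

local notation "E" => EuclideanSpace ℝ (Fin d)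

lemma clm_apply_eq_sum (L : E →L[ℝ] ℝ) (v : E) :
    L v = ∑ i, L (EuclideanSpace.single i 1) * v i := by
  conv_lhs => rw [← (EuclideanSpace.basisFun (Fin d) ℝ).sum_repr v]
  simp [mul_comm]

lemma contDiff_coord {n : WithTop ℕ∞} {φ : E → E} (hφ : ContDiff ℝ n φ) (i : Fin d) :
    ContDiff ℝ n fun x => φ x i :=
  (contDiff_piLp 2).1 hφ i

lemma HasCompactSupport.coord {φ : E → E} (hc : HasCompactSupport φ) (i : Fin d) :
    HasCompactSupport fun x => φ x i :=
  hc.comp_left (g := fun v : E => v i) rfl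

lemma fderiv_coord {φ : E → E} {x : E} (h : DifferentiableAt ℝ φ x) (i : Fin d) (v : E) :
    fderiv ℝ (fun y => φ y i) x v = (fderiv ℝ φ x v) i := by
  have := ((EuclideanSpace.proj i : E →L[ℝ] ℝ).hasFDerivAt.comp x h.hasFDerivAt).fderiv
  exact congrArg (fun L => L v) this

lemma continuous_divergence {φ : E → E} (hφ : ContDiff ℝ 1 φ) : Continuous (divergence φ) := by
  have := hφ.continuous_fderiv one_ne_zero
  unfold divergence
  fun_prop

lemma hasCompactSupport_divergence {φ : E → E} (hc : HasCompactSupport φ) :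
    HasCompactSupport (divergence φ) := by
  refine (hc.fderiv ℝ).mono fun x hx h0 => hx ?_
  simp [divergence, h0]

/-- Coordinatewise integration by parts for line derivatives; Rademacher's theorem reassembles them
into `fderiv` almost everywhere. -/
lemma LipschitzWith.integral_mul_divergence {C : NNReal} {f : E → ℝ} (hf : LipschitzWith C f)
    {φ : E → E} (hφ : ContDiff ℝ 1 φ) (hc : HasCompactSupport φ) :
    ∫ x, f x * divergence φ x = - ∫ x, fderiv ℝ f x (φ x) := by
  have hi : ∀ i : Fin d, ∫ x, f x * (fderiv ℝ φ x (EuclideanSpace.single i 1)) i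
      = - ∫ x, lineDeriv ℝ f x (EuclideanSpace.single i 1) * φ x i := by
    intro i
    obtain ⟨D, hD⟩ := (contDiff_coord hφ i).lipschitzWith_of_hasCompactSupport (hc.coord i)
      one_ne_zero
    rw [hf.integral_lineDeriv_mul_eq hD (hc.coord i), ← integral_neg]
    congr 1 with x
    have hdx := hφ.differentiable one_ne_zero x
    rw [((contDiff_coord hφ i).differentiable one_ne_zero x).lineDeriv_eq_fderiv, map_neg,
      fderiv_coord hdx]
    ring
  have hae : ∀ᵐ x : E, fderiv ℝ f x (φ x)
      = ∑ i, lineDeriv ℝ f x (EuclideanSpace.single i 1) * φ x i := by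
    filter_upwards [hf.ae_differentiableAt] with x hx
    rw [clm_apply_eq_sum]
    simp [hx.lineDeriv_eq_fderiv]
  have hint1 : ∀ i : Fin d, Integrable fun x : E =>
      f x * (fderiv ℝ φ x (EuclideanSpace.single i 1)) i := by
    intro i
    have h1 := hφ.continuous_fderiv one_ne_zero
    refine Continuous.integrable_of_hasCompactSupport (hf.continuous.mul (by fun_prop)) ?_
    refine (hc.fderiv ℝ).mono fun x hx h0 => hx ?_
    simp [h0]
  have hint2 : ∀ i : Fin d, Integrable fun x : E =>
      lineDeriv ℝ f x (EuclideanSpace.single i 1) * φ x i := by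
    intro i
    exact ((contDiff_coord hφ i).continuous.integrable_of_hasCompactSupport
      (hc.coord i)).bdd_mul (aestronglyMeasurable_lineDeriv hf.continuous volume)
      (.of_forall fun x => norm_lineDeriv_le_of_lipschitz ℝ hf)
  rw [integral_congr_ae hae, integral_finsetSum _ fun i _ => hint2 i, ← Finset.sum_neg_distrib]
  simp only [divergence, Finset.mul_sum]
  rw [integral_finsetSum _ fun i _ => hint1 i]
  exact Finset.sum_congr rfl fun i _ => hi i


/-- Equal to `1` on `{g ≤ 1}`, to `0` on `{1 + ε ≤ g}`, and affine in `g` in between. -/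
noncomputable def rampCutoff (ε : ℝ) (g : E → ℝ) (x : E) : ℝ :=
  max 0 (min 1 (1 - (g x - 1) / ε))

lemma lipschitzWith_rampCutoff {ε : NNReal} {K : NNReal} {g : E → ℝ}
    (hg : LipschitzWith K g) : LipschitzWith (K / ε) (rampCutoff ε g) := by
  refine LipschitzWith.const_max (LipschitzWith.const_min ?_ 1) 0
  refine LipschitzWith.of_dist_le_mul fun x y => ?_
  have h := hg.dist_le_mul x y
  rw [Real.dist_eq] at h ⊢
  have : 1 - (g x - 1) / (ε : ℝ) - (1 - (g y - 1) / ε) = - ((g x - g y) / ε) := by ring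
  rw [this, abs_neg, abs_div, abs_of_nonneg (show (0 : ℝ) ≤ ε from ε.2), NNReal.coe_div, div_mul_eq_mul_div]
  exact div_le_div_of_nonneg_right h ε.2

/-- A zero is a minimum. Where `f` is not differentiable, `fderiv` is 0 by convention. -/
lemma fderiv_eq_zero_of_eq_zero {f : E → ℝ} (h0 : ∀ x, 0 ≤ f x) {x : E} (hx : f x = 0) :
    fderiv ℝ f x = 0 :=
  IsLocalMin.fderiv_eq_zero (.of_forall fun y => hx ▸ h0 y)

lemma fderiv_eq_zero_of_eq_one {f : E → ℝ} (h1 : ∀ x, f x ≤ 1) {x : E} (hx : f x = 1) :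
    fderiv ℝ f x = 0 :=
  IsLocalMax.fderiv_eq_zero (.of_forall fun y => hx ▸ h1 y)

lemma norm_fderiv_apply_le {K : NNReal} {f : E → ℝ} (hf : LipschitzWith K f) {x v : E}
    (hv : ‖v‖ ≤ 1) : ‖fderiv ℝ f x v‖ ≤ K :=
  ((fderiv ℝ f x).le_of_opNorm_le (norm_fderiv_le_of_lipschitz ℝ hf) v).trans
    (mul_le_of_le_one_right K.2 hv)

/-- Integrate the divergence against the cutoff `f`: both its gradient and the error of replacing
the indicator of `s` by `f` live on the layer `T \ s`. -/
lemma integral_divergence_sub_le {s T : Set E} (hs : MeasurableSet s) (hT : MeasurableSet T)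
    (hTv : volume T ≠ ⊤) (hsT : s ⊆ T) {K : NNReal} {f : E → ℝ} (hf : LipschitzWith K f)
    (h0 : ∀ x, 0 ≤ f x) (h1 : ∀ x, f x ≤ 1) (hfs : ∀ x ∈ s, f x = 1) (hfT : ∀ x ∉ T, f x = 0)
    {φ : E → E} (hφ : ContDiff ℝ 1 φ) (hc : HasCompactSupport φ) (hφ1 : ∀ x, ‖φ x‖ ≤ 1)
    {M : ℝ} (hM : ∀ x, |divergence φ x| ≤ M) :
    ∫ x in s, divergence φ x ≤ (K + M) * volume.real (T \ s) := by
  have hint := (continuous_divergence hφ).integrable_of_hasCompactSupport (μ := volume)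
    (hasCompactSupport_divergence hc)
  have hintf : Integrable fun x => f x * divergence φ x :=
    hint.bdd_mul (c := 1) hf.continuous.aestronglyMeasurable
      (.of_forall fun x => by rw [Real.norm_of_nonneg (h0 x)]; exact h1 x)
  have hTs : volume (T \ s) ≠ ⊤ := ne_top_of_le_ne_top hTv (measure_mono Set.sdiff_subset)
  have hm : MeasurableSet (T \ s) := hT.diff hs
  have h2 : ∫ x, f x * divergence φ x =
      (∫ x in s, divergence φ x) + ∫ x in T \ s, f x * divergence φ x := by
    rw [← setIntegral_eq_integral_of_forall_compl_eq_zero (s := T)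
      fun x hx => by rw [hfT x hx, zero_mul]]
    rw [← integral_inter_add_sdiff hs hintf.integrableOn, Set.inter_eq_right.2 hsT]
    congr 1
    exact setIntegral_congr_fun hs fun x hx => by simp [hfs x hx]
  have h3 : ‖∫ x in T \ s, f x * divergence φ x‖ ≤ M * volume.real (T \ s) := by
    refine norm_setIntegral_le_of_norm_le_const hTs.lt_top fun x _ => ?_
    rw [norm_mul, Real.norm_of_nonneg (h0 x)]
    exact (mul_le_of_le_one_left (norm_nonneg _) (h1 x)).trans (hM x)
  have h4 : ‖∫ x, fderiv ℝ f x (φ x)‖ ≤ K * volume.real (T \ s) := by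
    rw [← setIntegral_eq_integral_of_forall_compl_eq_zero (s := T \ s)]
    · exact norm_setIntegral_le_of_norm_le_const hTs.lt_top
        fun x _ => norm_fderiv_apply_le hf (hφ1 x)
    · intro x hx
      by_cases hxs : x ∈ s
      · simp [fderiv_eq_zero_of_eq_one h1 (hfs x hxs)]
      · simp [fderiv_eq_zero_of_eq_zero h0 (hfT x fun hxT => hx ⟨hxT, hxs⟩)]
  have h5 := hf.integral_mul_divergence hφ hc
  rw [Real.norm_eq_abs] at h3 h4
  linarith [abs_le.1 h3, abs_le.1 h4]

/-- The gauge about `x₀` is 1/r-Lipschitz, so the ramp has slope at most 1/(rε). Its layer lies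
between Ω and its dilate by 1 + ε and has volume ((1 + ε)^d - 1)V; as ε → 0 the product tends to
dV/r. -/
lemma integral_divergence_le_of_ball_subset {Ω : Set E} (hopen : IsOpen Ω)
    (hbdd : Bornology.IsBounded Ω) (hconv : Convex ℝ Ω) {x₀ : E} {r : ℝ} (hr : 0 < r)
    (hball : Metric.ball x₀ r ⊆ Ω)
    {φ : E → E} (hφ : ContDiff ℝ 1 φ) (hc : HasCompactSupport φ) (hφ1 : ∀ x, ‖φ x‖ ≤ 1) :
    ∫ x in Ω, divergence φ x ≤ d * volume.real Ω / r := by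
  obtain ⟨M, hM⟩ := (continuous_divergence hφ).bounded_above_of_compact_support
    (hasCompactSupport_divergence hc)
  lift r to NNReal using hr.le
  set V := volume.real Ω
  set S : Set E := (fun y => y + x₀) ⁻¹' Ω with hS
  have hSo : IsOpen S := hopen.preimage (by fun_prop)
  have hSc : Convex ℝ S := hconv.translate_preimage_left x₀
  have hSball : Metric.ball (0 : E) r ⊆ S := fun y hy => hball (by simpa using hy)
  have hS0 : (0 : E) ∈ S := hSball (by simpa using hr)
  have hSV : volume.real S = V := by
    simp only [measureReal_def, hS, V, measure_preimage_add_right]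
  set g : E → ℝ := fun x => gauge S (x - x₀)
  have hgL : LipschitzWith r⁻¹ g := by
    have := (hSc.lipschitzWith_gauge (by simpa using hr) hSball).comp
      ((IsometryEquiv.subRight x₀).isometry.lipschitz)
    rwa [mul_one] at this
  have hmem : ∀ y, gauge S y < 1 ↔ y ∈ S := fun y =>
    Set.ext_iff.1 (setOfPred_gauge_lt_one_eq_self_of_isOpen hSc hS0 hSo) y
  have hΩ : Ω = {x | g x < 1} := by
    ext x
    simpa [hS] using (hmem (x - x₀)).symm
  have hlevel : ∀ ε : ℝ, 0 < ε → volume.real {x | g x < 1 + ε} = (1 + ε) ^ d * V := by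
    intro ε hε
    have hset : {x | g x < 1 + ε} = (fun x => x - x₀) ⁻¹' ((1 + ε) • S) := by
      ext x
      rw [Set.mem_preimage, Set.mem_smul_set_iff_inv_smul_mem₀ (by positivity), ← hmem]
      simp only [Set.mem_ofPred_eq, g]
      rw [gauge_smul_of_nonneg (by positivity), smul_eq_mul, inv_mul_lt_one₀ (by positivity)]
    rw [hset, measureReal_def]
    simp only [sub_eq_add_neg, measure_preimage_add_right]
    rw [Measure.addHaar_smul, ENNReal.toReal_mul, ← measureReal_def, hSV]
    rw [finrank_euclideanSpace_fin, abs_of_pos (by positivity),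
      ENNReal.toReal_ofReal (by positivity)]
  have hVfin : volume Ω ≠ ⊤ := hbdd.measure_lt_top.ne
  have key : ∀ ε : ℝ, 0 < ε → ∫ x in Ω, divergence φ x ≤
      (1 / r + ε * M) * (ε⁻¹ * ((1 + ε) ^ d - 1)) * V := by
    intro ε hε
    rcases eq_or_ne V 0 with hV | hV
    · have : volume Ω = 0 := (measureReal_eq_zero_iff hVfin).1 hV
      simp [hV, Measure.restrict_eq_zero.2 this]
    have hTfin : volume {x | g x < 1 + ε} ≠ ⊤ := by
      intro h
      have := hlevel ε hε
      rw [measureReal_def, h] at this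
      have : 0 < (1 + ε) ^ d * V := by positivity
      simp_all
    lift ε to NNReal using hε.le
    have hsT : Ω ⊆ {x | g x < 1 + ε} := by
      rw [hΩ]
      intro x hx
      simp only [Set.mem_ofPred_eq] at hx ⊢
      linarith
    have hTm : MeasurableSet {x | g x < 1 + ε} :=
      (isOpen_lt hgL.continuous continuous_const).measurableSet
    have h := integral_divergence_sub_le hopen.measurableSet hTm hTfin hsT
      (lipschitzWith_rampCutoff (ε := ε) hgL)
      (fun x => le_max_left _ _) (fun x => max_le zero_le_one (min_le_left _ _))
      (fun x hx => ?_) (fun x hx => ?_) hφ hc hφ1 hM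
    · rw [measureReal_sdiff hsT hopen.measurableSet hTfin, hlevel ε hε] at h
      convert h using 1
      push_cast
      field_simp
      ring
    · rw [hΩ, Set.mem_ofPred_eq] at hx
      have : (g x - 1) / ε ≤ 0 := div_nonpos_of_nonpos_of_nonneg (by linarith) hε.le
      rw [rampCutoff, min_eq_left (by linarith), max_eq_right zero_le_one]
    · rw [Set.mem_ofPred_eq, not_lt] at hx
      have : 1 ≤ (g x - 1) / ε := by rw [le_div_iff₀ hε]; linarith
      exact max_eq_left ((min_le_right _ _).trans (by linarith))
  have hlim : Filter.Tendsto (fun ε : ℝ => (1 / r + ε * M) * (ε⁻¹ * ((1 + ε) ^ d - 1)) * V)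
      (nhdsWithin 0 (Set.Ioi 0)) (nhds ((1 / r + 0 * M) * d * V)) := by
    have h1 : HasDerivAt (fun ε : ℝ => (1 + ε) ^ d) d 0 := by
      simpa using! ((hasDerivAt_id (0 : ℝ)).const_add 1).pow d
    have h2 := h1.tendsto_slope_zero_right
    simp only [zero_add, add_zero, one_pow, smul_eq_mul] at h2
    refine ((Filter.Tendsto.const_add _ (Filter.Tendsto.mul_const _ ?_)).mul h2).mul_const _
    exact tendsto_nhdsWithin_of_tendsto_nhds Filter.tendsto_id
  have := ge_of_tendsto hlim (by filter_upwards [self_mem_nhdsWithin] with ε hε using key ε hε)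
  calc _ ≤ _ := this
    _ = _ := by ring

theorem perimeter_le_of_ball_subset {Ω : Set E} (hopen : IsOpen Ω)
    (hbdd : Bornology.IsBounded Ω) (hconv : Convex ℝ Ω) {x₀ : E} {r : ℝ} (hr : 0 < r)
    (hball : Metric.ball x₀ r ⊆ Ω) :
    perimeter Ω ≤ ENNReal.ofReal (d * volume.real Ω / r) :=
  iSup₂_le fun _ hφ => ENNReal.ofReal_le_ofReal
    (integral_divergence_le_of_ball_subset hopen hbdd hconv hr hball hφ.1 hφ.2.1 hφ.2.2)

end Divergence

/-! ### Concavity of the distance to the complement, and convex extension -/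

section ConvexExtension

variable {F : Type*} [NormedAddCommGroup F] [NormedSpace ℝ F]

lemma concaveOn_infDist_compl {Ω : Set F} (hopen : IsOpen Ω) (hconv : Convex ℝ Ω)
    (hc : (Ωᶜ).Nonempty) : ConcaveOn ℝ Ω fun x => Metric.infDist x Ωᶜ := by
  refine ⟨hconv, fun y hy y' hy' a b ha hb hab => ?_⟩
  have hpos : ∀ {y}, y ∈ Ω → 0 < Metric.infDist y Ωᶜ := fun {y} hy =>
    (hopen.isClosed_compl.notMem_iff_infDist_pos hc).1 (fun h => h hy)
  set R := a • Metric.infDist y Ωᶜ + b • Metric.infDist y' Ωᶜ with hR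
  have hR0 : 0 < R := by
    rcases ha.eq_or_lt with rfl | ha
    · have : b = 1 := by linarith
      simpa [hR, this] using hpos hy'
    · have := mul_pos ha (hpos hy)
      have := mul_nonneg hb (hpos hy').le
      simp only [hR, smul_eq_mul]
      linarith
  refine (Metric.le_infDist hc).2 fun z hz => ?_
  by_contra! hlt
  refine hz ?_
  rw [dist_comm, dist_eq_norm] at hlt
  set w := z - (a • y + b • y') with hw
  -- The displacement `w` is shared out in proportion to the radii of the balls about `y` and `y'`
  -- contained in Ω; the convex combination of the two shifted points is `z`.
  have hin : ∀ {y}, y ∈ Ω → y + (Metric.infDist y Ωᶜ / R) • w ∈ Ω := by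
    intro y hy
    refine Metric.ball_infDist_compl_subset (x := y) ?_
    rw [mem_ball_iff_norm, add_sub_cancel_left, norm_smul, Real.norm_of_nonneg
      (div_nonneg (hpos hy).le hR0.le), div_mul_eq_mul_div, div_lt_iff₀ hR0]
    exact mul_lt_mul_of_pos_left hlt (hpos hy)
  have h := hconv (hin hy) (hin hy') ha hb hab
  have hone : a * (Metric.infDist y Ωᶜ / R) + b * (Metric.infDist y' Ωᶜ / R) = 1 := by
    simp only [smul_eq_mul] at hR
    rw [← mul_div_assoc, ← mul_div_assoc, ← add_div, ← hR, div_self hR0.ne']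
  have h2 : a • (y + (Metric.infDist y Ωᶜ / R) • w) + b • (y' + (Metric.infDist y' Ωᶜ / R) • w)
      = (a • y + b • y') +
        (a * (Metric.infDist y Ωᶜ / R) + b * (Metric.infDist y' Ωᶜ / R)) • w := by
    module
  rw [h2, hone, one_smul, hw, add_sub_cancel] at h
  exact h

/-- The infimal convolution of `f` with the norm: the McShane extension, which inherits convexity
because f(y) + dist x y is jointly convex. -/
lemma ConvexOn.exists_lipschitzWith_extension {Ω : Set F} (hne : Ω.Nonempty) {f : F → ℝ}
    (hf : ConvexOn ℝ Ω f) (hL : LipschitzOnWith 1 f Ω) :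
    ∃ s : F → ℝ, ConvexOn ℝ Set.univ s ∧ LipschitzWith 1 s ∧ Set.EqOn s f Ω := by
  have : Nonempty Ω := hne.to_subtype
  set s : F → ℝ := fun x => ⨅ y : Ω, (f y + dist x (y : F)) with hs
  have hLip : ∀ y ∈ Ω, ∀ z ∈ Ω, f y ≤ f z + dist y z := fun y hy z hz => by
    have := hL.dist_le_mul y hy z hz
    rw [Real.dist_eq, NNReal.coe_one, one_mul] at this
    linarith [abs_le.1 this]
  have hbdd : ∀ x : F, BddBelow (Set.range fun y : Ω => f y + dist x y) := by
    intro x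
    obtain ⟨y₀, hy₀⟩ := hne
    refine ⟨f y₀ - dist x y₀, ?_⟩
    rintro _ ⟨y, rfl⟩
    dsimp only
    linarith [hLip y₀ hy₀ y y.2, dist_triangle_left y₀ y x]
  refine ⟨s, ⟨convex_univ, fun x _ x' _ a b ha hb hab => ?_⟩, ?_, fun x hx => ?_⟩
  · refine le_of_forall_pos_le_add fun ε hε => ?_
    obtain ⟨y, hy⟩ := exists_lt_of_ciInf_lt (show s x < s x + ε by linarith)
    obtain ⟨y', hy'⟩ := exists_lt_of_ciInf_lt (show s x' < s x' + ε by linarith)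
    have h1 : s (a • x + b • x') ≤ f (a • (y : F) + b • (y' : F)) +
        dist (a • x + b • x') (a • (y : F) + b • (y' : F)) :=
      ciInf_le (hbdd _) ⟨_, hf.1 y.2 y'.2 ha hb hab⟩
    have h2 := hf.2 y.2 y'.2 ha hb hab
    have h3 : dist (a • x + b • x') (a • (y : F) + b • (y' : F)) ≤ a * dist x y + b * dist x' y' := by
      refine (dist_add_add_le _ _ _ _).trans (le_of_eq ?_)
      rw [dist_smul₀, dist_smul₀, Real.norm_of_nonneg ha, Real.norm_of_nonneg hb]
    have h4 := mul_le_mul_of_nonneg_left hy.le ha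
    have h5 := mul_le_mul_of_nonneg_left hy'.le hb
    simp only [smul_eq_mul] at h2 ⊢
    have : a * ε + b * ε = ε := by rw [← add_mul, hab, one_mul]
    linarith
  · refine LipschitzWith.of_le_add fun x x' => ?_
    rw [← sub_le_iff_le_add]
    refine le_ciInf fun y => ?_
    have := ciInf_le (hbdd x) y
    have := dist_triangle x x' y
    simp only [hs]
    linarith
  · refine le_antisymm ((ciInf_le (hbdd x) ⟨x, hx⟩).trans (by simp)) ?_
    exact le_ciInf fun y => hLip x hx y y.2

end ConvexExtension

/-! ### Smoothing convex Lipschitz functions -/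

section Mollify

variable {F : Type*} [NormedAddCommGroup F] [NormedSpace ℝ F] [FiniteDimensional ℝ F]

open scoped ContDiff Convolution

/-- Convolution with a bump of mass 1 averages translates, which preserves convexity and the
Lipschitz constant; a bump supported within radius ε moves values by at most ε. -/
lemma ConvexOn.exists_contDiff_approx {s : F → ℝ} (hs : ConvexOn ℝ Set.univ s)
    (hL : LipschitzWith 1 s) {ε : ℝ} (hε : 0 < ε) :
    ∃ u : F → ℝ, ContDiff ℝ ∞ u ∧ ConvexOn ℝ Set.univ u ∧ LipschitzWith 1 u ∧
      ∀ x, |u x - s x| ≤ ε := by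
  borelize F
  let μ : Measure F := Measure.addHaar
  let η : ContDiffBump (0 : F) := ⟨ε / 2, ε, half_pos hε, half_lt_self hε⟩
  have hcont := hL.continuous
  have hint : ∀ x, Integrable (fun t => η.normed μ t * s (x - t)) μ := fun x =>
    Continuous.integrable_of_hasCompactSupport
      (η.continuous_normed.mul (hcont.comp (by fun_prop))) η.hasCompactSupport_normed.mul_right
  have hint1 : Integrable (η.normed μ) μ :=
    η.continuous_normed.integrable_of_hasCompactSupport η.hasCompactSupport_normed
  have hη := η.nonneg_normed (μ := μ)
  set u : F → ℝ := η.normed μ ⋆[ContinuousLinearMap.lsmul ℝ ℝ, μ] s with hu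
  have hudef : ∀ x, u x = ∫ t, η.normed μ t * s (x - t) ∂μ := fun x => rfl
  refine ⟨u, ?_, ⟨convex_univ, fun x _ y _ a b ha hb hab => ?_⟩, ?_, fun x => ?_⟩
  · exact η.hasCompactSupport_normed.contDiff_convolution_left _ η.contDiff_normed
      hcont.locallyIntegrable
  · simp only [smul_eq_mul, hudef]
    rw [← integral_const_mul, ← integral_const_mul,
      ← integral_add ((hint x).const_mul a) ((hint y).const_mul b)]
    refine integral_mono (hint _) (((hint x).const_mul a).add ((hint y).const_mul b)) fun t => ?_
    have h := hs.2 (Set.mem_univ (x - t)) (Set.mem_univ (y - t)) ha hb hab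
    have e : a • (x - t) + b • (y - t) = a • x + b • y - t := by
      rw [smul_sub, smul_sub, sub_add_sub_comm, ← add_smul, hab, one_smul]
    rw [e] at h
    simp only [smul_eq_mul] at h ⊢
    calc _ ≤ _ := mul_le_mul_of_nonneg_left h (hη t)
      _ = _ := by ring
  · refine LipschitzWith.of_le_add fun x y => ?_
    have h1 : dist x y = ∫ t, η.normed μ t * dist x y ∂μ := by
      rw [integral_mul_const, η.integral_normed, one_mul]
    rw [h1, hudef, hudef, ← integral_add (hint y) (hint1.mul_const _)]
    refine integral_mono (hint x) ((hint y).add (hint1.mul_const _)) fun t => ?_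
    have h := hL.dist_le_mul (x - t) (y - t)
    rw [dist_sub_right, Real.dist_eq, NNReal.coe_one, one_mul] at h
    simp only
    rw [← mul_add]
    exact mul_le_mul_of_nonneg_left (by linarith [abs_le.1 h]) (hη t)
  · rw [← Real.dist_eq]
    refine η.dist_normed_convolution_le hcont.aestronglyMeasurable fun y hy => ?_
    have h := hL.dist_le_mul y x
    rw [NNReal.coe_one, one_mul] at h
    exact h.trans (Metric.mem_ball.1 hy).le

end Mollify

/-! ### Derivatives of convex functions and their limits -/

section ConvexDeriv

open Filter Topology

variable {F : Type*} [NormedAddCommGroup F] [NormedSpace ℝ F]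

lemma ConvexOn.comp_line {u : F → ℝ} (hu : ConvexOn ℝ Set.univ u) (x v : F) :
    ConvexOn ℝ Set.univ fun t : ℝ => u (x + t • v) := by
  have := hu.comp_affineMap (AffineMap.lineMap x (x + v))
  simpa [AffineMap.lineMap_apply, Function.comp_def, add_comm] using! this

lemma hasDerivAt_comp_line {G : Type*} [NormedAddCommGroup G] [NormedSpace ℝ G] {u : F → G}
    (hu : Differentiable ℝ u) (x v : F) (t : ℝ) :
    HasDerivAt (fun t : ℝ => u (x + t • v)) (fderiv ℝ u (x + t • v) v) t := by
  have h1 : HasDerivAt (fun t : ℝ => x + t • v) v t := by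
    simpa using ((hasDerivAt_id t).smul_const v).const_add x
  exact (hu _).hasFDerivAt.comp_hasDerivAt t h1

lemma ConvexOn.fderiv_apply_le_slope {u : F → ℝ} (hu : ConvexOn ℝ Set.univ u)
    (hd : Differentiable ℝ u) (x v : F) {h : ℝ} (hh : 0 < h) :
    fderiv ℝ u x v ≤ h⁻¹ * (u (x + h • v) - u x) := by
  have := (hu.comp_line x v).le_slope_of_hasDerivAt (Set.mem_univ 0) (Set.mem_univ h) hh
    (hasDerivAt_comp_line hd x v 0)
  simpa [slope_def_field, div_eq_inv_mul] using this

lemma ConvexOn.monotone_fderiv_line {u : F → ℝ} (hu : ConvexOn ℝ Set.univ u)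
    (hd : Differentiable ℝ u) (x v : F) : Monotone fun t : ℝ => fderiv ℝ u (x + t • v) v := by
  have h := (hu.comp_line x v).monotoneOn_deriv
    fun t _ => (hasDerivAt_comp_line hd x v t).differentiableAt
  rw [monotoneOn_univ] at h
  convert h using 2 with t
  exact (hasDerivAt_comp_line hd x v t).deriv.symm

/-- Convex difference quotients bound derivatives from above and pass to the limit, giving the upper
estimate; the direction `-v` gives the lower one. -/
lemma tendsto_fderiv_of_convexOn {ι : Type*} {l : Filter ι} {u : ι → F → ℝ} {s : F → ℝ}
    (hu : ∀ n, ConvexOn ℝ Set.univ (u n)) (hd : ∀ n, Differentiable ℝ (u n))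
    (hlim : ∀ x, Tendsto (fun n => u n x) l (𝓝 (s x))) {x : F} (hs : DifferentiableAt ℝ s x)
    (v : F) : Tendsto (fun n => fderiv ℝ (u n) x v) l (𝓝 (fderiv ℝ s x v)) := by
  have key : ∀ w : F, ∀ a, fderiv ℝ s x w < a → ∀ᶠ n in l, fderiv ℝ (u n) x w < a := by
    intro w a ha
    have h1 := hs.hasFDerivAt.hasLineDerivAt w
    have h2 := HasDerivAt.tendsto_slope_zero_right h1
    simp only [zero_smul, add_zero, zero_add, smul_eq_mul] at h2
    obtain ⟨h, hha, hh⟩ := ((h2.eventually_lt_const ha).and self_mem_nhdsWithin).exists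
    have h3 : Tendsto (fun n => h⁻¹ * (u n (x + h • w) - u n x)) l
        (𝓝 (h⁻¹ * (s (x + h • w) - s x))) := ((hlim _).sub (hlim _)).const_mul _
    filter_upwards [h3.eventually_lt_const hha] with n hn
    exact ((hu n).fderiv_apply_le_slope (hd n) x w hh).trans_lt hn
  refine tendsto_order.2 ⟨fun a ha => ?_, key v⟩
  filter_upwards [key (-v) (-a) (by rw [map_neg]; linarith)] with n hn
  rw [map_neg] at hn
  linarith

end ConvexDeriv

/-! ### Volume at most inradius times perimeter -/

section VolumeLe

open Filter Topology

variable {d : ℕ}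

local notation "E" => EuclideanSpace ℝ (Fin d)

/-- The vector of partial derivatives of `u`. -/
noncomputable def gradField (u : E → ℝ) (x : E) : E :=
  WithLp.toLp 2 fun i => fderiv ℝ u x (EuclideanSpace.single i 1)

lemma fderiv_apply_eq_inner_gradField (u : E → ℝ) (x v : E) :
    fderiv ℝ u x v = inner ℝ (gradField u x) v := by
  rw [clm_apply_eq_sum, PiLp.inner_apply]
  simp [gradField, mul_comm]

lemma norm_gradField_le {u : E → ℝ} (hu : LipschitzWith 1 u) (x : E) : ‖gradField u x‖ ≤ 1 := by
  have h := (fderiv ℝ u x).le_of_opNorm_le (norm_fderiv_le_of_lipschitz ℝ hu) (gradField u x)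
  rw [fderiv_apply_eq_inner_gradField, real_inner_self_eq_norm_sq, NNReal.coe_one, one_mul,
    Real.norm_of_nonneg (by positivity)] at h
  by_contra! h1
  nlinarith

lemma contDiff_gradField {u : E → ℝ} (hu : ContDiff ℝ 2 u) : ContDiff ℝ 1 (gradField u) := by
  refine (contDiff_piLp 2).2 fun i => ?_
  exact (hu.fderiv_right (m := 1) (by norm_num)).clm_apply contDiff_const

/-- The divergence is the trace of the Hessian, and each diagonal entry is the derivative of a
monotone function. -/
lemma divergence_gradField_nonneg {u : E → ℝ} (hu : ContDiff ℝ 2 u)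
    (hconv : ConvexOn ℝ Set.univ u) (x : E) : 0 ≤ divergence (gradField u) x := by
  refine Finset.sum_nonneg fun i _ => ?_
  have hd := (contDiff_gradField hu).differentiable one_ne_zero
  have h := hasDerivAt_comp_line (fun y => differentiableAt_euclidean.1 (hd y) i) x
    (EuclideanSpace.single i 1) 0
  rw [zero_smul, add_zero, fderiv_coord (hd x)] at h
  rw [← h.deriv]
  exact (hconv.monotone_fderiv_line (hu.differentiable two_ne_zero) x _).deriv_nonneg

/-- Towards a nearest point of the complement the distance decreases with slope at least one;
Cauchy–Schwarz concludes. -/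
lemma one_le_norm_gradField_infDist_compl {Ω : Set E} (hopen : IsOpen Ω) (hc : (Ωᶜ).Nonempty)
    {x : E} (hx : x ∈ Ω) (hdx : DifferentiableAt ℝ (fun y => Metric.infDist y Ωᶜ) x) :
    1 ≤ ‖gradField (fun y => Metric.infDist y Ωᶜ) x‖ := by
  set δ : E → ℝ := fun y => Metric.infDist y Ωᶜ with hδ
  obtain ⟨y, hy, hxy⟩ := hopen.isClosed_compl.exists_infDist_eq_dist hc x
  have hpos : 0 < dist x y := dist_pos.2 fun h => hy (h ▸ hx)
  have hle : ∀ t : ℝ, 0 < t → t < 1 → t⁻¹ * (δ (x + t • (y - x)) - δ x) ≤ - dist x y := by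
    intro t ht ht1
    have h1 : δ (x + t • (y - x)) ≤ (1 - t) * dist x y := by
      refine (Metric.infDist_le_dist_of_mem hy).trans (le_of_eq ?_)
      have : x + t • (y - x) - y = (1 - t) • (x - y) := by module
      rw [dist_eq_norm, this, norm_smul, Real.norm_of_nonneg (by linarith), dist_eq_norm]
    have h2 : δ x = dist x y := hxy
    rw [inv_mul_le_iff₀ ht]
    linarith
  have hlim := HasDerivAt.tendsto_slope_zero_right (hdx.hasFDerivAt.hasLineDerivAt (y - x))
  simp only [zero_smul, add_zero, zero_add, smul_eq_mul] at hlim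
  have h3 : fderiv ℝ δ x (y - x) ≤ - dist x y := by
    refine le_of_tendsto hlim ?_
    filter_upwards [Ioo_mem_nhdsGT (zero_lt_one : (0 : ℝ) < 1)] with t ht using hle t ht.1 ht.2
  rw [fderiv_apply_eq_inner_gradField] at h3
  have h4 := abs_real_inner_le_norm (gradField δ x) (y - x)
  rw [← dist_eq_norm y x, dist_comm y x] at h4
  have h5 := neg_le_abs (inner ℝ (gradField δ x) (y - x))
  exact le_of_mul_le_mul_right (by linarith) hpos

lemma divergence_congr {φ ψ : E → E} {x : E} (h : φ =ᶠ[𝓝 x] ψ) :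
    divergence φ x = divergence ψ x := by
  simp only [divergence, h.fderiv_eq]

lemma exists_admissible_eqOn {Ω : Set E} (hbdd : Bornology.IsBounded Ω) {φ : E → E}
    (hφ : ContDiff ℝ 1 φ) (hφ1 : ∀ x, ‖φ x‖ ≤ 1) :
    ∃ ψ : E → E, ContDiff ℝ 1 ψ ∧ HasCompactSupport ψ ∧ (∀ x, ‖ψ x‖ ≤ 1) ∧
      ∀ x ∈ Ω, ψ =ᶠ[𝓝 x] φ := by
  obtain ⟨R, hR, hΩ⟩ := hbdd.subset_ball_lt 0 0
  let χ : ContDiffBump (0 : E) := ⟨R, R + 1, hR, by linarith⟩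
  refine ⟨fun x => χ x • φ x, χ.contDiff.smul hφ, χ.hasCompactSupport.smul_right, fun x => ?_,
    fun x hx => ?_⟩
  · rw [norm_smul, Real.norm_of_nonneg χ.nonneg]
    exact mul_le_one₀ χ.le_one (norm_nonneg _) (hφ1 x)
  · filter_upwards [Metric.isOpen_ball.mem_nhds (hΩ hx)] with y hy
    rw [χ.one_of_mem_closedBall (Metric.ball_subset_closedBall hy), one_smul]

lemma ofReal_integral_divergence_le_perimeter (Ω : Set E) {φ : E → E}
    (hφ : ContDiff ℝ 1 φ) (hc : HasCompactSupport φ) (hφ1 : ∀ x, ‖φ x‖ ≤ 1) :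
    ENNReal.ofReal (∫ x in Ω, divergence φ x) ≤ perimeter Ω :=
  le_iSup₂_of_le φ ⟨hφ, hc, hφ1⟩ le_rfl

lemma fderiv_infDist_compl_of_notMem {Ω : Set E} {x : E} (hx : x ∉ Ω) :
    fderiv ℝ (fun y => Metric.infDist y Ωᶜ) x = 0 :=
  fderiv_eq_zero_of_eq_zero (fun _ => Metric.infDist_nonneg)
    (Metric.infDist_zero_of_mem (s := Ωᶜ) hx)

/-- Since the distance vanishes off Ω, integration by parts leaves no boundary term. As div ∇u ≥ 0,
the distance may be replaced by its bound `ρ`. -/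
lemma neg_integral_fderiv_infDist_gradField_le {Ω : Set E} (hopen : IsOpen Ω)
    (hbdd : Bornology.IsBounded Ω) {ρ : ℝ} (hρ : ∀ x ∈ Ω, Metric.infDist x Ωᶜ ≤ ρ)
    (hP : perimeter Ω ≠ ⊤) {u : E → ℝ} (hu : ContDiff ℝ 2 u) (hconv : ConvexOn ℝ Set.univ u)
    (hL : LipschitzWith 1 u) (hρ0 : 0 ≤ ρ) :
    - ∫ x in Ω, fderiv ℝ (fun y => Metric.infDist y Ωᶜ) x (gradField u x) ≤
      ρ * (perimeter Ω).toReal := by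
  obtain ⟨ψ, hψ, hψc, hψ1, hψe⟩ := exists_admissible_eqOn hbdd (contDiff_gradField hu)
    (norm_gradField_le hL)
  have hδ : LipschitzWith 1 fun y : E => Metric.infDist y Ωᶜ := Metric.lipschitz_infDist_pt _
  have hint := (continuous_divergence hψ).integrable_of_hasCompactSupport (μ := volume)
    (hasCompactSupport_divergence hψc)
  have hint2 : Integrable fun x => Metric.infDist x Ωᶜ * divergence ψ x :=
    (hδ.continuous.mul (continuous_divergence hψ)).integrable_of_hasCompactSupport
      (hasCompactSupport_divergence hψc).mul_left
  have h1 : ∫ x in Ω, fderiv ℝ (fun y => Metric.infDist y Ωᶜ) x (gradField u x) =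
      ∫ x, fderiv ℝ (fun y => Metric.infDist y Ωᶜ) x (ψ x) := by
    refine (setIntegral_congr_fun hopen.measurableSet fun x hx => ?_).trans
      (setIntegral_eq_integral_of_forall_compl_eq_zero
        fun x hx => by rw [fderiv_infDist_compl_of_notMem hx]; rfl)
    simp only [(hψe x hx).self_of_nhds]
  rw [h1, ← hδ.integral_mul_divergence hψ hψc,
    ← setIntegral_eq_integral_of_forall_compl_eq_zero (s := Ω)
      fun x hx => by rw [Metric.infDist_zero_of_mem (s := Ωᶜ) hx, zero_mul]]
  have h2 : ∫ x in Ω, divergence ψ x ≤ (perimeter Ω).toReal :=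
    (ENNReal.ofReal_le_iff_le_toReal hP).1
      (ofReal_integral_divergence_le_perimeter Ω hψ hψc hψ1)
  refine le_trans ?_ (mul_le_mul_of_nonneg_left h2 hρ0)
  rw [← integral_const_mul]
  refine setIntegral_mono_on hint2.integrableOn (hint.const_mul ρ).integrableOn
    hopen.measurableSet fun x hx => mul_le_mul_of_nonneg_right (hρ x hx) ?_
  rw [divergence_congr (hψe x hx)]
  exact divergence_gradField_nonneg hu hconv x

theorem volume_le_mul_perimeter {Ω : Set E} (hne : Ω.Nonempty) (hopen : IsOpen Ω)
    (hbdd : Bornology.IsBounded Ω) (hΩ : Convex ℝ Ω) (hc : (Ωᶜ).Nonempty) {ρ : ℝ}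
    (hρ : ∀ x ∈ Ω, Metric.infDist x Ωᶜ ≤ ρ) (hP : perimeter Ω ≠ ⊤) :
    volume.real Ω ≤ ρ * (perimeter Ω).toReal := by
  have hρ0 : 0 ≤ ρ := Metric.infDist_nonneg.trans (hρ _ hne.some_mem)
  set δ : E → ℝ := fun y => Metric.infDist y Ωᶜ with hδdef
  have hδ : LipschitzWith 1 δ := Metric.lipschitz_infDist_pt _
  obtain ⟨s, hsconv, hsL, hsδ⟩ := (concaveOn_infDist_compl hopen hΩ hc).neg
    |>.exists_lipschitzWith_extension hne hδ.neg.lipschitzOnWith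
  have happrox := fun n : ℕ => hsconv.exists_contDiff_approx hsL
    (show (0 : ℝ) < 1 / ((n : ℝ) + 1) by positivity)
  choose u hu huconv huL hus using happrox
  have hu2 : ∀ n, ContDiff ℝ 2 (u n) := fun n => contDiff_infty.1 (hu n) 2
  have hlim : ∀ x, Tendsto (fun n => u n x) atTop (𝓝 (s x)) := fun x =>
    tendsto_iff_dist_tendsto_zero.2 (squeeze_zero (fun _ => dist_nonneg) (fun n => hus n x)
      tendsto_one_div_add_atTop_nhds_zero_nat)
  have hVfin : volume Ω ≠ ⊤ := hbdd.measure_lt_top.ne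
  -- On Ω the gradients of `u n` tend almost everywhere to -∇δ, and all integrands are bounded by 1.
  have hconv : Tendsto (fun n => ∫ x in Ω, fderiv ℝ δ x (gradField (u n) x)) atTop
      (𝓝 (∫ x in Ω, - ‖gradField δ x‖ ^ 2)) := by
    refine tendsto_integral_of_dominated_convergence (fun _ => 1) (fun n => ?_)
      (integrableOn_const hVfin) (fun n => .of_forall fun x => ?_) ?_
    · have h1 : Measurable (fderiv ℝ δ) := measurable_fderiv ℝ δ
      have h2 : Measurable (gradField (u n)) := (contDiff_gradField (hu2 n)).continuous.measurable
      have h3 : (fun x => fderiv ℝ δ x (gradField (u n) x)) =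
          fun x => ∑ i, fderiv ℝ δ x (EuclideanSpace.single i 1) * gradField (u n) x i := by
        ext x
        exact clm_apply_eq_sum _ _
      rw [h3]
      refine (Finset.measurable_sum _ fun i _ => ?_).aestronglyMeasurable
      exact (measurable_fderiv_apply_const ℝ δ _).mul (by fun_prop)
    · exact norm_fderiv_apply_le hδ (norm_gradField_le (huL n) x)
    · rw [ae_restrict_iff' hopen.measurableSet]
      filter_upwards [hδ.ae_differentiableAt] with x hdx hx
      have heq : s =ᶠ[𝓝 x] -δ := hsδ.eventuallyEq_of_mem (hopen.mem_nhds hx)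
      have hds : DifferentiableAt ℝ s x := hdx.neg.congr_of_eventuallyEq heq
      have h1 := tendsto_fderiv_of_convexOn huconv
        (fun n => (hu2 n).differentiable two_ne_zero) hlim hds (gradField δ x)
      rw [heq.fderiv_eq, fderiv_neg, neg_apply,
        fderiv_apply_eq_inner_gradField, real_inner_self_eq_norm_sq] at h1
      refine h1.congr fun n => ?_
      rw [fderiv_apply_eq_inner_gradField, fderiv_apply_eq_inner_gradField, real_inner_comm]
  have h1 : ∫ x in Ω, ‖gradField δ x‖ ^ 2 ≤ ρ * (perimeter Ω).toReal := by
    have := hconv.neg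
    rw [← integral_neg] at this
    simp only [neg_neg] at this
    exact le_of_tendsto' this fun n => neg_integral_fderiv_infDist_gradField_le hopen hbdd hρ hP
      (hu2 n) (huconv n) (huL n) hρ0
  refine le_trans ?_ h1
  have h2 : volume.real Ω = ∫ _ in Ω, (1 : ℝ) := by simp
  rw [h2]
  refine setIntegral_mono_ae_restrict (integrableOn_const hVfin) ?_ ?_
  · refine Measure.integrableOn_of_bounded hVfin (M := 1) ?_ (.of_forall fun x => ?_)
    · have : (fun x => ‖gradField δ x‖ ^ 2) =
          fun x => ∑ i, (fderiv ℝ δ x (EuclideanSpace.single i 1)) ^ 2 := by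
        ext x
        simp [EuclideanSpace.norm_sq_eq, gradField]
      rw [this]
      refine (Finset.measurable_sum _ fun i _ => ?_).aestronglyMeasurable
      exact (measurable_fderiv_apply_const ℝ δ _).pow_const 2
    · rw [Real.norm_of_nonneg (by positivity)]
      exact pow_le_one₀ (norm_nonneg _) (norm_gradField_le hδ x)
  · rw [EventuallyLE, ae_restrict_iff' hopen.measurableSet]
    filter_upwards [hδ.ae_differentiableAt] with x hdx hx
    exact one_le_pow₀ (one_le_norm_gradField_infDist_compl hopen hc hx hdx)

end VolumeLe

/-! ### Half ellipsoids in the hull of a ball and a point -/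

section Cone

variable {F : Type*} [NormedAddCommGroup F] [InnerProductSpace ℝ F]

lemma Convex.add_smul_add_mem {Ω : Set F} (hΩ : Convex ℝ Ω) {x p w : F} {r t : ℝ} (hr : 0 < r)
    (hball : Metric.ball x r ⊆ Ω) (hp : p ∈ Ω) (ht : 0 ≤ t) (hw : ‖w‖ + r * t < r) :
    x + (w + t • (p - x)) ∈ Ω := by
  have ht1 : 0 < 1 - t := by
    have := norm_nonneg w
    by_contra! h
    nlinarith
  have hz : x + (1 - t)⁻¹ • w ∈ Ω := by
    refine hball ?_
    rw [mem_ball_iff_norm, add_sub_cancel_left, norm_smul, Real.norm_of_nonneg (by positivity),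
      inv_mul_lt_iff₀ ht1]
    linarith
  have h := hΩ hp hz ht ht1.le (by ring)
  have e : t • p + (1 - t) • (x + (1 - t)⁻¹ • w) = x + (w + t • (p - x)) := by
    rw [smul_add, smul_inv_smul₀ ht1.ne']
    module
  rwa [e] at h

variable [FiniteDimensional ℝ F] [MeasurableSpace F] [BorelSpace F]

lemma volume_ball_le_two_mul_half {u : F} (hu : ‖u‖ = 1) :
    volume.real (Metric.ball (0 : F) 1) ≤
      2 * volume.real {y : F | y ∈ Metric.ball 0 1 ∧ 0 < inner ℝ u y} := by
  set H := {y : F | y ∈ Metric.ball 0 1 ∧ 0 < inner ℝ u y}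
  have hHfin : volume H ≠ ⊤ :=
    ne_top_of_le_ne_top measure_ball_lt_top.ne (measure_mono fun y hy => hy.1)
  have hneg : volume (-H) = volume H := Measure.measure_neg volume H
  have hker : volume ((LinearMap.ker (innerₛₗ ℝ u) : Submodule ℝ F) : Set F) = 0 := by
    refine Measure.addHaar_submodule volume _ fun h => ?_
    have : u ∈ LinearMap.ker (innerₛₗ ℝ u) := h ▸ Submodule.mem_top
    simp [hu] at this
  have hsub : Metric.ball (0 : F) 1 ⊆
      (H ∪ -H) ∪ ((LinearMap.ker (innerₛₗ ℝ u) : Submodule ℝ F) : Set F) := by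
    intro y hy
    rcases lt_trichotomy (inner ℝ u y) 0 with h | h | h
    · exact Or.inl (Or.inr ⟨by simpa using hy, by simpa using h⟩)
    · exact Or.inr (by simpa using h)
    · exact Or.inl (Or.inl ⟨hy, h⟩)
  have h : volume (Metric.ball (0 : F) 1) ≤ 2 * volume H :=
    calc _ ≤ _ := measure_mono hsub
      _ ≤ _ := measure_union_le _ _
      _ ≤ _ := by
        rw [hker, add_zero, two_mul]
        exact (measure_union_le _ _).trans (by rw [hneg])
  simpa [measureReal_def] using ENNReal.toReal_mono (ENNReal.mul_ne_top (by simp) hHfin) h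

/-- The part of a convex set lying beyond the centre of an inscribed ball in the direction of one
of its points contains an affine half ellipsoid. -/
lemma half_volume_le_of_ball_subset {Ω : Set F} (hΩ : Convex ℝ Ω) (hfin : volume Ω ≠ ⊤)
    {x p u : F} {r : ℝ} (hr : 0 < r) (hball : Metric.ball x r ⊆ Ω) (hp : p ∈ Ω) (hu : ‖u‖ = 1) :
    volume.real (Metric.ball (0 : F) 1) / 2 * (√2)⁻¹ ^ Module.finrank ℝ F *
        r ^ (Module.finrank ℝ F - 1) * inner ℝ u (p - x) ≤
      volume.real (Ω ∩ {z | 0 < inner ℝ u (z - x)}) := by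
  rcases le_or_gt (inner ℝ u (p - x)) 0 with hh | hh
  · exact (mul_nonpos_of_nonneg_of_nonpos (by positivity) hh).trans measureReal_nonneg
  set h := inner ℝ u (p - x) with hdef
  -- For the orthogonal and axial parts a, t of a vector in the unit ball, a + t ≤ √2·√(a² + t²);
  -- shrinking by 1/√2 puts the image of the half ball inside the cone.
  set c := (√2)⁻¹ with hc
  have hc0 : 0 < c := by positivity
  have hc2 : c ^ 2 = 1 / 2 := by rw [hc, inv_pow, Real.sq_sqrt zero_le_two]; norm_num
  -- Up to the factor `c`, `T` scales the complement of `u` by `r` and sends `u` to `p - x`; the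
  -- transvection form yields the determinant.
  set T : F →ₗ[ℝ] F := (c * r) • LinearMap.transvection (innerₛₗ ℝ u) (r⁻¹ • (p - x) - u)
  have huu : inner ℝ u u = (1 : ℝ) := by rw [real_inner_self_eq_norm_sq, hu, one_pow]
  have hTy : ∀ y, T y = (c * r) • (y - inner ℝ u y • u) + (c * inner ℝ u y) • (p - x) := by
    intro y
    have : T y = (c * r) • (y + inner ℝ u y • (r⁻¹ • (p - x) - u)) := by
      simp [T, LinearMap.transvection.apply]
    rw [this]
    have e : c * inner ℝ u y = c * r * (inner ℝ u y * r⁻¹) := by field_simp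
    rw [e]
    module
  have hn : Module.finrank ℝ F ≠ 0 := by
    have : Nontrivial F := nontrivial_of_ne u 0 (norm_ne_zero_iff.1 (by rw [hu]; norm_num))
    exact Module.finrank_pos.ne'
  have hdet : LinearMap.det T = c ^ Module.finrank ℝ F * r ^ (Module.finrank ℝ F - 1) * h := by
    rw [LinearMap.det_smul, LinearMap.transvection.det]
    simp only [innerₛₗ_apply_apply, inner_sub_right, inner_smul_right, huu]
    rw [← inner_sub_right, ← hdef, mul_pow]
    obtain ⟨n, hn⟩ := Nat.exists_eq_succ_of_ne_zero hn
    rw [hn, Nat.succ_sub_one, Nat.succ_eq_add_one]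
    field_simp
    ring
  set H := {y : F | y ∈ Metric.ball 0 1 ∧ 0 < inner ℝ u y}
  have hsub : (fun y => x + y) '' (T '' H) ⊆ Ω ∩ {z | 0 < inner ℝ u (z - x)} := by
    rintro _ ⟨_, ⟨y, ⟨hy1, hy0⟩, rfl⟩, rfl⟩
    set t := inner ℝ u y with ht
    have horth : ‖y - t • u‖ ^ 2 = ‖y‖ ^ 2 - t ^ 2 := by
      rw [norm_sub_sq_real, norm_smul, hu, inner_smul_right, real_inner_comm, ← ht,
        Real.norm_eq_abs, mul_one, sq_abs]
      ring
    have hy : ‖y‖ ^ 2 < 1 := by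
      rw [mem_ball_zero_iff] at hy1
      exact pow_lt_one₀ (norm_nonneg _) hy1 two_ne_zero
    refine ⟨?_, ?_⟩
    · simp only [hTy]
      refine hΩ.add_smul_add_mem hr hball hp (by positivity) ?_
      rw [norm_smul, Real.norm_of_nonneg (by positivity)]
      have hlt : c * (‖y - t • u‖ + t) < 1 := by
        refine lt_of_pow_lt_pow_left₀ 2 zero_le_one ?_
        rw [mul_pow, hc2]
        nlinarith [sq_nonneg (‖y - t • u‖ - t)]
      nlinarith
    · simp only [Set.mem_ofPred_eq, add_sub_cancel_left, hTy, inner_add_right, inner_smul_right,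
        inner_sub_right (𝕜 := ℝ) u y, huu]
      rw [← hdef, ← ht]
      have : 0 < c * t * h := by positivity
      linarith
  have hvol : volume.real ((fun y => x + y) '' (T '' H)) =
      c ^ Module.finrank ℝ F * r ^ (Module.finrank ℝ F - 1) * h * volume.real H := by
    rw [measureReal_def, Set.image_add_left, measure_preimage_add,
      Measure.addHaar_image_linearMap, ENNReal.toReal_mul, ENNReal.toReal_ofReal (abs_nonneg _),
      hdet, abs_of_nonneg (by positivity), measureReal_def]
  have hmono := measureReal_mono hsub (ne_top_of_le_ne_top hfin (measure_mono Set.inter_subset_left))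
  rw [hvol] at hmono
  refine le_trans ?_ hmono
  have := volume_ball_le_two_mul_half hu
  have h0 : 0 ≤ c ^ Module.finrank ℝ F * r ^ (Module.finrank ℝ F - 1) * h := by positivity
  nlinarith

/-- With `u` along `p - q`, the half ellipsoids towards `p` and `q` lie on opposite sides of the
hyperplane through `x`, and their heights add up to `dist p q`. -/
theorem dist_mul_pow_le_volume {Ω : Set F} (hopen : IsOpen Ω) (hΩ : Convex ℝ Ω)
    (hfin : volume Ω ≠ ⊤) {x p q : F} {r : ℝ} (hr : 0 < r) (hball : Metric.ball x r ⊆ Ω)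
    (hp : p ∈ Ω) (hq : q ∈ Ω) :
    volume.real (Metric.ball (0 : F) 1) / 2 * (√2)⁻¹ ^ Module.finrank ℝ F *
        r ^ (Module.finrank ℝ F - 1) * dist p q ≤ volume.real Ω := by
  rcases eq_or_ne p q with rfl | hpq
  · simp
  have hpos : 0 < ‖p - q‖ := norm_pos_iff.2 (sub_ne_zero.2 hpq)
  set u := ‖p - q‖⁻¹ • (p - q) with hu
  have hu1 : ‖u‖ = 1 := by
    rw [hu, norm_smul, norm_inv, norm_norm, inv_mul_cancel₀ hpos.ne']
  have h1 := half_volume_le_of_ball_subset hΩ hfin hr hball hp hu1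
  have h2 := half_volume_le_of_ball_subset hΩ hfin hr hball hq (u := -u) (by rwa [norm_neg])
  have hd : inner ℝ u (p - x) + inner ℝ (-u) (q - x) = dist p q := by
    rw [inner_neg_left, ← sub_eq_add_neg, ← inner_sub_right, sub_sub_sub_cancel_right, hu,
      inner_smul_left, real_inner_self_eq_norm_sq, dist_eq_norm]
    simp only [conj_trivial]
    field_simp
  have hm : MeasurableSet (Ω ∩ {z | 0 < inner ℝ (-u) (z - x)}) :=
    hopen.measurableSet.inter (isOpen_lt continuous_const (by fun_prop)).measurableSet
  have hdisj : Disjoint (Ω ∩ {z | 0 < inner ℝ u (z - x)})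
      (Ω ∩ {z | 0 < inner ℝ (-u) (z - x)}) := by
    refine Set.disjoint_left.2 fun z hz hz' => ?_
    have h3 : 0 < inner ℝ u (z - x) := hz.2
    have h4 : 0 < inner ℝ (-u) (z - x) := hz'.2
    rw [inner_neg_left] at h4
    linarith
  have h3 := measureReal_union hdisj hm
    (ne_top_of_le_ne_top hfin (measure_mono Set.inter_subset_left))
    (ne_top_of_le_ne_top hfin (measure_mono Set.inter_subset_left))
  have h4 := measureReal_mono
    (Set.union_subset Set.inter_subset_left Set.inter_subset_left :
      (Ω ∩ {z | 0 < inner ℝ u (z - x)}) ∪ (Ω ∩ {z | 0 < inner ℝ (-u) (z - x)}) ⊆ Ω) hfin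
  rw [← hd, mul_add]
  linarith

end Cone

/-! ### The four basic inequalities in terms of the inradius -/

section Inradius

variable {d : ℕ}

local notation "E" => EuclideanSpace ℝ (Fin d)

lemma bddAbove_inradius_set (hd : d ≠ 0) {A : Set E} (hA : Bornology.IsBounded A) :
    BddAbove {r : ℝ | 0 < r ∧ ∃ x ∈ A, Metric.ball x r ⊆ A} := by
  refine ⟨2 * Metric.diam A, ?_⟩
  rintro r ⟨hr, x, hx, hball⟩
  let e : E := EuclideanSpace.single ⟨0, Nat.pos_of_ne_zero hd⟩ (r / 2)
  have he : ‖e‖ = r / 2 := by simp [e, abs_of_pos hr]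
  have hmem : x + e ∈ A := hball (by rw [mem_ball_iff_norm, add_sub_cancel_left, he]; linarith)
  have := Metric.dist_le_diam_of_mem hA hmem hx
  rw [dist_eq_norm, add_sub_cancel_left, he] at this
  linarith

lemma le_inradius (hd : d ≠ 0) {A : Set E} (hA : Bornology.IsBounded A) {x : E} {r : ℝ}
    (hr : 0 < r) (hx : x ∈ A) (hball : Metric.ball x r ⊆ A) : r ≤ inradius A :=
  le_csSup (bddAbove_inradius_set hd hA) ⟨hr, x, hx, hball⟩

lemma nonempty_inradius_set {A : Set E} (hne : A.Nonempty) (hopen : IsOpen A) :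
    {r : ℝ | 0 < r ∧ ∃ x ∈ A, Metric.ball x r ⊆ A}.Nonempty := by
  obtain ⟨x, hx⟩ := hne
  obtain ⟨r, hr, hball⟩ := Metric.isOpen_iff.1 hopen x hx
  exact ⟨r, hr, x, hx, hball⟩

lemma inradius_pos (hd : d ≠ 0) {A : Set E} (hne : A.Nonempty) (hopen : IsOpen A)
    (hA : Bornology.IsBounded A) : 0 < inradius A := by
  obtain ⟨r, hr, x, hx, hball⟩ := nonempty_inradius_set hne hopen
  exact hr.trans_le (le_inradius hd hA hr hx hball)

lemma perimeter_ne_top {Ω : Set E} (hne : Ω.Nonempty) (hopen : IsOpen Ω)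
    (hbdd : Bornology.IsBounded Ω) (hconv : Convex ℝ Ω) : perimeter Ω ≠ ⊤ := by
  obtain ⟨r, hr, x, -, hball⟩ := nonempty_inradius_set hne hopen
  exact ne_top_of_le_ne_top ENNReal.ofReal_ne_top
    (perimeter_le_of_ball_subset hopen hbdd hconv hr hball)

lemma volume_le_inradius_mul_perimeter (hd : d ≠ 0) {Ω : Set E} (hne : Ω.Nonempty)
    (hopen : IsOpen Ω) (hbdd : Bornology.IsBounded Ω) (hconv : Convex ℝ Ω) :
    volume.real Ω ≤ inradius Ω * (perimeter Ω).toReal := by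
  have : Nonempty (Fin d) := ⟨⟨0, Nat.pos_of_ne_zero hd⟩⟩
  have hc : (Ωᶜ).Nonempty := by
    rw [Set.nonempty_compl]
    rintro rfl
    exact NormedSpace.unbounded_univ ℝ E hbdd
  refine volume_le_mul_perimeter hne hopen hbdd hconv hc (fun x hx => ?_)
    (perimeter_ne_top hne hopen hbdd hconv)
  exact le_inradius hd hbdd ((hopen.isClosed_compl.notMem_iff_infDist_pos hc).1 (fun h => h hx)) hx
    Metric.ball_infDist_compl_subset

lemma inradius_mul_perimeter_le (hd : d ≠ 0) {Ω : Set E} (hne : Ω.Nonempty)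
    (hopen : IsOpen Ω) (hbdd : Bornology.IsBounded Ω) (hconv : Convex ℝ Ω)
    (hP : 0 < (perimeter Ω).toReal) :
    inradius Ω * (perimeter Ω).toReal ≤ d * volume.real Ω := by
  rw [← le_div_iff₀ hP]
  refine csSup_le (nonempty_inradius_set hne hopen) ?_
  rintro r ⟨hr, x, -, hball⟩
  have h := ENNReal.toReal_mono ENNReal.ofReal_ne_top
    (perimeter_le_of_ball_subset hopen hbdd hconv hr hball)
  rw [ENNReal.toReal_ofReal (by positivity), le_div_iff₀ hr] at h
  rw [le_div_iff₀ hP]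
  linarith

lemma unitBallVolume_pos (d : ℕ) : 0 < unitBallVolume d :=
  ENNReal.toReal_pos (Metric.measure_ball_pos _ _ one_pos).ne' measure_ball_lt_top.ne

lemma sqrt_two_pow_le (hd : 2 ≤ d) : √2 ^ d ≤ (d : ℝ) ^ (d - 1) :=
  calc √2 ^ d ≤ √2 ^ (2 * (d - 1)) :=
        pow_le_pow_right₀ (Real.one_le_sqrt.2 one_le_two) (by omega)
    _ = 2 ^ (d - 1) := by rw [pow_mul, Real.sq_sqrt zero_le_two]
    _ ≤ _ := pow_le_pow_left₀ zero_le_two (by exact_mod_cast hd) _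

lemma diam_mul_inradius_pow_le (hd : 2 ≤ d) {Ω : Set E} (hne : Ω.Nonempty)
    (hopen : IsOpen Ω) (hbdd : Bornology.IsBounded Ω) (hconv : Convex ℝ Ω) :
    Metric.diam Ω * unitBallVolume d * inradius Ω ^ (d - 1) ≤
      2 * (d : ℝ) ^ (d - 1) * volume.real Ω := by
  have hω : 0 < unitBallVolume d := unitBallVolume_pos d
  have hρ := inradius_pos (by omega) hne hopen hbdd
  -- The estimate is a closed condition on the radius, so it passes to the supremum without an
  -- inscribed ball attaining it.
  have hmem := csSup_mem_closure (nonempty_inradius_set hne hopen)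
    (bddAbove_inradius_set (by omega) hbdd)
  have key : ∀ p ∈ Ω, ∀ q ∈ Ω, dist p q * unitBallVolume d * inradius Ω ^ (d - 1) ≤
      2 * (d : ℝ) ^ (d - 1) * volume.real Ω := by
    intro p hp q hq
    have hclosed : IsClosed {r : ℝ | dist p q * unitBallVolume d * r ^ (d - 1) ≤
      2 * (d : ℝ) ^ (d - 1) * volume.real Ω} := isClosed_le (by fun_prop) continuous_const
    refine closure_minimal ?_ hclosed hmem
    rintro r ⟨hr, x, -, hball⟩
    have h := dist_mul_pow_le_volume hopen hconv hbdd.measure_lt_top.ne hr hball hp hq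
    rw [finrank_euclideanSpace_fin, inv_pow, ← unitBallVolume] at h
    have h2 := sqrt_two_pow_le hd
    have h3 : 0 < √2 ^ d := by positivity
    rw [Set.mem_ofPred_eq]
    calc dist p q * unitBallVolume d * r ^ (d - 1)
        = 2 * √2 ^ d * (unitBallVolume d / 2 * (√2 ^ d)⁻¹ * r ^ (d - 1) * dist p q) := by
          field_simp
      _ ≤ 2 * √2 ^ d * volume.real Ω := by gcongr
      _ ≤ _ := by gcongr
  have hpos : 0 < unitBallVolume d * inradius Ω ^ (d - 1) := by positivity
  have : Metric.diam Ω ≤ 2 * (d : ℝ) ^ (d - 1) * volume.real Ω /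
      (unitBallVolume d * inradius Ω ^ (d - 1)) := by
    refine Metric.diam_le_of_forall_dist_le (by positivity) fun p hp q hq => ?_
    rw [le_div_iff₀ hpos, ← mul_assoc]
    exact key p hp q hq
  rwa [le_div_iff₀ hpos, ← mul_assoc] at this

lemma volume_le_unitBallVolume_mul {Ω : Set E} (hopen : IsOpen Ω)
    (hbdd : Bornology.IsBounded Ω) :
    volume.real Ω ≤ unitBallVolume d * (Metric.diam Ω / 2) ^ d := by
  have h := volume_le_volume_ball_half_diam hopen.measurableSet hbdd
  have hD := Metric.diam_nonneg (s := Ω)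
  rw [Measure.addHaar_closedBall _ _ (by positivity), finrank_euclideanSpace_fin] at h
  have := ENNReal.toReal_mono
    (ENNReal.mul_ne_top ENNReal.ofReal_ne_top measure_ball_lt_top.ne) h
  rw [ENNReal.toReal_mul, ENNReal.toReal_ofReal (by positivity)] at this
  rw [mul_comm]
  exact this

end Inradius

/-! ### Combination of the four inequalities -/

theorem lemma2 (d : ℕ) (hd : 2 ≤ d) (Ω : Set (EuclideanSpace ℝ (Fin d)))
    (hne : Ω.Nonempty) (hopen : IsOpen Ω) (hbdd : Bornology.IsBounded Ω)
    (hconv : Convex ℝ Ω) :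
    (perimeter Ω ≠ 0 ∧ perimeter Ω ≠ ⊤) ∧
    (volume.real Ω) ^ (((d : ℝ) - 1) / d) / (perimeter Ω).toReal
      ≤ (d : ℝ) ^ (((d : ℝ) - 1) / d) / (unitBallVolume d) ^ (1 / (d : ℝ))
        * (2 * inradius Ω / Metric.diam Ω) ^ (1 / (d : ℝ)) ∧
    Metric.diam Ω
      ≤ 2 * (d : ℝ) ^ (d - 1) / unitBallVolume d
        * ((perimeter Ω).toReal ^ (d - 1) / (volume.real Ω) ^ (d - 2)) ∧
    (volume.real Ω) ^ (((d : ℝ) - 1) / d) / (perimeter Ω).toReal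
      ≥ 1 / ((d : ℝ) * (unitBallVolume d) ^ (1 / (d : ℝ)))
        * (2 * inradius Ω / Metric.diam Ω) := by
  have hd0 : d ≠ 0 := by omega
  have hω : 0 < unitBallVolume d := unitBallVolume_pos d
  have hV : 0 < volume.real Ω :=
    ENNReal.toReal_pos (hopen.measure_pos volume hne).ne' hbdd.measure_lt_top.ne
  have hρ := inradius_pos hd0 hne hopen hbdd
  have hPtop := perimeter_ne_top hne hopen hbdd hconv
  have hVP := volume_le_inradius_mul_perimeter hd0 hne hopen hbdd hconv
  have hP : 0 < (perimeter Ω).toReal := pos_of_mul_pos_right (hV.trans_le hVP) hρ.le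
  have hPV := inradius_mul_perimeter_le hd0 hne hopen hbdd hconv hP
  have hDV := diam_mul_inradius_pow_le hd hne hopen hbdd hconv
  have hiso := volume_le_unitBallVolume_mul hopen hbdd
  have hD : 0 < Metric.diam Ω := by
    refine Metric.diam_nonneg.lt_of_ne fun h => ?_
    rw [← h, zero_div, zero_pow hd0, mul_zero] at hiso
    linarith
  have hP0 : perimeter Ω ≠ 0 := fun h => by simp [h] at hP
  generalize (perimeter Ω).toReal = P at *
  generalize volume.real Ω = V at *
  generalize inradius Ω = ρ at *
  generalize Metric.diam Ω = D at *
  generalize unitBallVolume d = ω at *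
  have hdR : (0 : ℝ) < d := by positivity
  have hdiam : D * ω * V ^ (d - 2) ≤ 2 * (d : ℝ) ^ (d - 1) * P ^ (d - 1) := by
    obtain ⟨n, rfl⟩ := Nat.exists_eq_add_of_le' hd
    simp only [Nat.add_sub_cancel, show n + 2 - 1 = n + 1 by omega] at hDV ⊢
    -- One factor `ρ` is cancelled after bounding V by ρP; the other `n` are traded for V^n ≤ (ρP)^n
    -- below.
    have h1 : D * ω * ρ ^ n ≤ 2 * ((n + 2 : ℕ) : ℝ) ^ (n + 1) * P := by
      refine le_of_mul_le_mul_right ?_ hρ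
      calc D * ω * ρ ^ n * ρ = D * ω * ρ ^ (n + 1) := by ring
        _ ≤ _ := hDV
        _ ≤ 2 * ((n + 2 : ℕ) : ℝ) ^ (n + 1) * (ρ * P) := by gcongr
        _ = _ := by ring
    calc D * ω * V ^ n ≤ D * ω * (ρ * P) ^ n := by gcongr
      _ = D * ω * ρ ^ n * P ^ n := by ring
      _ ≤ 2 * ((n + 2 : ℕ) : ℝ) ^ (n + 1) * P * P ^ n := by gcongr
      _ = _ := by ring
  have hexp : ∀ x : ℝ, 0 ≤ x → x ^ (((d : ℝ) - 1) / d) = (x ^ (d - 1)) ^ (1 / (d : ℝ)) := by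
    intro x hx
    rw [← Real.rpow_natCast x (d - 1), ← Real.rpow_mul hx, Nat.cast_sub (by omega), Nat.cast_one,
      mul_one_div]
  have hroot : ∀ x : ℝ, 0 ≤ x → (x ^ d) ^ (1 / (d : ℝ)) = x := by
    intro x hx
    rw [one_div, Real.pow_rpow_inv_natCast hx hd0]
  refine ⟨⟨hP0, hPtop⟩, ?_, ?_, ?_⟩
  · rw [hexp V hV.le, hexp d hdR.le, ← Real.div_rpow (by positivity) hω.le,
      ← Real.mul_rpow (by positivity) (by positivity)]
    -- Writing P as (P^d)^(1/d) brings both sides under a single power 1/d.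
    nth_rw 1 [← hroot P hP.le]
    rw [← Real.div_rpow (by positivity) (by positivity)]
    refine Real.rpow_le_rpow (by positivity) ?_ (by positivity)
    rw [div_mul_div_comm, div_le_div_iff₀ (by positivity) (by positivity)]
    calc V ^ (d - 1) * (ω * D) = V * (D * ω * V ^ (d - 2)) := by
          rw [show d - 1 = d - 2 + 1 by omega]; ring
      _ ≤ ρ * P * (2 * (d : ℝ) ^ (d - 1) * P ^ (d - 1)) := by gcongr
      _ = (d : ℝ) ^ (d - 1) * (2 * ρ) * P ^ (d - 1 + 1) := by ring
      _ = _ := by rw [Nat.sub_add_cancel (by omega)]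
  · rw [div_mul_div_comm, le_div_iff₀ (by positivity), ← mul_assoc]
    exact hdiam
  · have h1 : V ^ (1 / (d : ℝ)) ≤ ω ^ (1 / (d : ℝ)) * (D / 2) := by
      rw [← hroot (D / 2) (by positivity), ← Real.mul_rpow hω.le (by positivity)]
      exact Real.rpow_le_rpow hV.le hiso (by positivity)
    have h2 : V ^ (((d : ℝ) - 1) / d) = V / V ^ (1 / (d : ℝ)) := by
      rw [sub_div, div_self hdR.ne', Real.rpow_sub hV, Real.rpow_one]
    have ha : 0 < V ^ (1 / (d : ℝ)) := by positivity
    have hb : 0 < ω ^ (1 / (d : ℝ)) := by positivity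
    rw [h2, ge_iff_le, div_div, div_mul_div_comm, div_le_div_iff₀ (by positivity) (by positivity)]
    calc 1 * (2 * ρ) * (V ^ (1 / (d : ℝ)) * P) = 2 * (ρ * P) * V ^ (1 / (d : ℝ)) := by ring
      _ ≤ 2 * (d * V) * (ω ^ (1 / (d : ℝ)) * (D / 2)) := by gcongr
      _ = _ := by ring
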